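/- All rings are commutative with unit and ring homomorphisms preserve the unit. For a ring $A$, $\mathrm{Spec}(A)$ is its prime spectrum with the Zariski topology and $\mathrm{Max}(A)\subseteq \mathrm{Spec}(A)$ is the subspace of maximal ideals. A real $C^{*}$-algebra is a commutative ring isomorphic to the ring $C(X,\mathbb R)$ of all continuous real-valued functions on some compact Hausdorff space $X$; a complex $C^{*}$-algebra means a commutative unital $C^{*}$-algebra over $\mathbb C$. A prime ideal $P$ of a ring $A$ is called almost maximal if for every family $(c_i)_{i\in I}$ of elements of $A$ and every $c\in A$ such that 1. for each $i\in I$ there are an integer $n_i>0$ and $u_i\in A$ with $c_i^{n_i}=c\,u_i$, and 2. for any finitely many $d_1,\dots,d_n\in A$ with $(c,d_1,\dots,d_n)=A$ there is a finite subset $J\subseteq I$ such that the $d_k$ $(1\le k\le n)$ together with the $c_j$ $(j\in J)$ generate the ideal $A$, one has: if $c\notin P$ then $c_i\notin P$ for some $i\in I$. A ring homomorphism $f:A\to B$ is called maximal if $f^{-1}:\mathrm{Spec}(B)\to \mathrm{Spec}(A)$ restricts to a continuous map $\mathrm{Max}(B)\to \mathrm{Max}(A)$; in particular $f^{-1}(M)$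 is then a maximal ideal of $A$ for each maximal ideal $M$ of $B$. **Theorem.** (i) Let $A$ be a real or complex $C^{*}$-algebra. A prime ideal $P$ of $A$ is maximal if and only if it is almost maximal. (ii) Let $A$ and $B$ be both real or both complex $C^{*}$-algebras, and let $f:A\to B$ be a homomorphism of such algebras, that is, in the real case an arbitrary ring homomorphism, and in the complex case a ring homomorphism with $f(a^{*})=f(a)^{*}$ for all $a\in A$ (no linearity over $\mathbb C$ is assumed). Then $f$ is a maximal homomorphism of rings. -/

import Mathlib

universe u v

/-- A real C*-algebra: a commutative ring with unit that is (up to isomorphism of rings) the ring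
of all continuous real-valued functions on a compact Hausdorff space. -/
def IsRealCStarAlgebra (A : Type u) [CommRing A] : Prop :=
  ∃ (X : Type u) (_ : TopologicalSpace X) (_ : CompactSpace X) (_ : T2Space X),
    Nonempty (A ≃+* C(X, ℝ))

/-- The family `c'` covers `c`: each `c' i` has a positive power which is a multiple of `c`, and
whenever `c` together with finitely many elements `d` generates the unit ideal, finitely many of
the `c' i` together with the elements of `d` generate the unit ideal. -/
structure MaxCovers {A : Type u} [CommRing A] {ι : Type u} (c' : ι → A) (c : A) : Prop where
  exists_pow_eq : ∀ i, ∃ (n : ℕ) (a : A), 0 < n ∧ c' i ^ n = c * a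
  exists_finset : ∀ d : Finset A, Ideal.span ({c} ∪ (d : Set A)) = ⊤ →
    ∃ J : Finset ι, Ideal.span ((d : Set A) ∪ c' '' (J : Set ι)) = ⊤

/-- An almost maximal ideal: a prime ideal `P` such that, for every family `c'` covering an
element `c ∉ P`, some member of the family lies outside `P`. -/
structure IsAlmostMaximal {A : Type u} [CommRing A] (P : Ideal A) : Prop where
  isPrime : P.IsPrime
  exists_notMem : ∀ (ι : Type u) (c' : ι → A) (c : A), MaxCovers c' c → c ∉ P → ∃ i, c' i ∉ P

/-- A ring homomorphism `f : A → B` is maximal if `f⁻¹ : Spec B → Spec A` restricts to a continuous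
map `Max B → Max A`, where maximal spectra carry the topology induced by the Zariski topology. -/
def IsMaximalHom {A : Type u} {B : Type v} [CommRing A] [CommRing B] (f : A →+* B) : Prop :=
  ∃ g : MaximalSpectrum B → MaximalSpectrum A, Continuous g ∧
    ∀ M : MaximalSpectrum B,
      (g M).toPrimeSpectrum = PrimeSpectrum.comap f M.toPrimeSpectrum

/-! Maximal ideals of `C(X, 𝕜)` are the ideals of functions vanishing at a point. For (i), suppose
`P ≤ M` with `M` the ideal at `x`, and `c ∈ M` but `c ∉ P`. The truncations `max (‖c‖ - ε) 0` cover
`c` (`maxCovers_normTrunc`), so one lies outside `P`; it is annihilated by `max (ε - ‖c‖) 0`, which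
is thus in `P ≤ M` yet equals `ε` at `x`. For (ii), constants already make each evaluation of `f`
surjective onto the field: a ring endomorphism of `ℝ` is the identity, and a star-preserving one of
`ℂ` is the identity or conjugation. -/

theorem Ideal.IsMaximal.isAlmostMaximal {A : Type u} [CommRing A] {P : Ideal A}
    (hP : P.IsMaximal) : IsAlmostMaximal P := by
  refine ⟨hP.isPrime, fun ι c' c hc hcP => ?_⟩
  -- Here `y * c + i = 1` with `i ∈ P`, so `{i}` is a legitimate test set for the covering.
  obtain ⟨y, i, hi, hy⟩ := hP.exists_inv hcP
  obtain ⟨J, hJ⟩ := hc.exists_finset {i} <| by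
    rw [Ideal.eq_top_iff_one, ← hy]
    exact add_mem (Ideal.mul_mem_left _ _ (Ideal.subset_span (by simp)))
      (Ideal.subset_span (by simp))
  by_contra! h
  refine hP.ne_top (top_le_iff.1 (hJ ▸ Ideal.span_le.2 ?_))
  rintro _ (ha | ⟨j, -, rfl⟩)
  · simpa [Finset.mem_singleton.1 ha] using hi
  · exact h j

section Truncation

variable {X 𝕜 : Type*} [RCLike 𝕜] [TopologicalSpace X]

/-- The continuous function `max (‖g‖ - ε) 0`. -/
def ContinuousMap.normTrunc (g : C(X, 𝕜)) (ε : ℝ) : C(X, 𝕜) where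
  toFun x := ((max (‖g x‖ - ε) 0 : ℝ) : 𝕜)

theorem ContinuousMap.normTrunc_ne_zero {g : C(X, 𝕜)} {ε : ℝ} {x : X} :
    g.normTrunc ε x ≠ 0 ↔ ε < ‖g x‖ := by
  simp [normTrunc]

theorem ContinuousMap.dvd_normTrunc (g : C(X, 𝕜)) {ε : ℝ} (hε : 0 < ε) :
    g ∣ g.normTrunc ε := by
  have hpos (x : X) : 0 < max ‖g x‖ ε := lt_max_of_lt_right hε
  -- The denominator `‖g x‖ ^ 2` matters only where `‖g x‖ > ε`; replacing it by `max ‖g x‖ ε ^ 2`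
  -- keeps the quotient continuous.
  refine ⟨⟨fun x => star (g x) * ((max (‖g x‖ - ε) 0 / max ‖g x‖ ε ^ 2 : ℝ) : 𝕜), ?_⟩, ?_⟩
  · have h : Continuous fun x => max (‖g x‖ - ε) 0 / max ‖g x‖ ε ^ 2 :=
      Continuous.div (by fun_prop) (by fun_prop) fun x => (pow_pos (hpos x) 2).ne'
    exact (map_continuous g).star.mul (RCLike.continuous_ofReal.comp h)
  · ext x
    simp only [normTrunc, coe_mk, mul_apply, ← mul_assoc, RCLike.star_def, RCLike.mul_conj]
    rw [← RCLike.ofReal_pow, ← RCLike.ofReal_mul, RCLike.ofReal_inj]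
    rcases le_total ‖g x‖ ε with h | h
    · simp [max_eq_right (sub_nonpos.2 h)]
    · have := hε.trans_le h
      rw [max_eq_left h]
      field_simp

end Truncation

section RingOfFunctions

variable {A : Type*} [CommRing A] {X 𝕜 : Type*} [RCLike 𝕜] [TopologicalSpace X] [CompactSpace X]
  [T2Space X]

theorem Ideal.IsMaximal.exists_mem_iff_apply_eq_zero (e : A ≃+* C(X, 𝕜)) {M : Ideal A}
    (hM : M.IsMaximal) : ∃ x, ∀ a, a ∈ M ↔ e a x = 0 := by
  have hN : (M.comap (e.symm : C(X, 𝕜) →+* A)).IsMaximal :=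
    Ideal.comap_isMaximal_of_surjective _ e.symm.surjective
  obtain ⟨x, hx⟩ := (ContinuousMap.ideal_isMaximal_iff _).1 hN
  refine ⟨x, fun a => ?_⟩
  rw [← ContinuousMap.mem_idealOfSet_compl_singleton, hx]
  simp [Ideal.mem_comap]

theorem Ideal.span_eq_top_iff_forall_exists_apply_ne_zero (e : A ≃+* C(X, 𝕜)) (s : Set A) :
    Ideal.span s = ⊤ ↔ ∀ x, ∃ a ∈ s, e a x ≠ 0 := by
  constructor
  · intro h x
    by_contra! hs
    have hle : Ideal.span s ≤
        RingHom.ker ((ContinuousMap.evalAlgHom 𝕜 𝕜 x : C(X, 𝕜) →+* 𝕜).comp (e : A →+* C(X, 𝕜))) :=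
      Ideal.span_le.2 fun a ha => by simpa [RingHom.mem_ker] using hs a ha
    exact RingHom.ker_ne_top _ (top_le_iff.1 (h ▸ hle))
  · intro h
    by_contra hne
    obtain ⟨M, hM, hle⟩ := Ideal.exists_le_maximal _ hne
    obtain ⟨x, hx⟩ := hM.exists_mem_iff_apply_eq_zero e
    obtain ⟨a, ha, hax⟩ := h x
    exact hax ((hx a).1 (hle (Ideal.subset_span ha)))

end RingOfFunctions

theorem maxCovers_normTrunc {A : Type u} [CommRing A] {X 𝕜 : Type*} [RCLike 𝕜]
    [TopologicalSpace X] [CompactSpace X] [T2Space X] (e : A ≃+* C(X, 𝕜)) (c : A) :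
    MaxCovers (fun n : ULift.{u} ℕ => e.symm ((e c).normTrunc (1 / (n.down + 1)))) c := by
  refine ⟨fun n => ?_, fun d hd => ?_⟩
  · obtain ⟨u, hu⟩ := (e c).dvd_normTrunc (Nat.one_div_pos_of_nat (α := ℝ) (n := n.down))
    exact ⟨1, e.symm u, one_pos, by rw [pow_one, hu, map_mul, e.symm_apply_apply]⟩
  · rw [Ideal.span_eq_top_iff_forall_exists_apply_ne_zero e] at hd
    -- On the common zero set of `d`, `c` has no zero, so the open sets `‖c‖ > 1 / (n + 1)` cover
    -- this compact set.
    have hK : IsCompact (⋂ a ∈ d, {x | e a x = 0}) :=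
      (isClosed_biInter fun a _ => isClosed_eq (map_continuous (e a)) continuous_const).isCompact
    obtain ⟨J, hJ⟩ := hK.elim_finite_subcover
      (fun n : ULift.{u} ℕ => {x | (e c).normTrunc (1 / (n.down + 1)) x ≠ 0})
      (fun n => isOpen_ne_fun (map_continuous _) continuous_const) <| by
        intro x hx
        simp only [Set.mem_iInter] at hx
        obtain ⟨a, rfl | ha, hax⟩ := hd x
        · obtain ⟨n, hn⟩ := exists_nat_one_div_lt (norm_pos_iff.2 hax)
          exact Set.mem_iUnion.2 ⟨⟨n⟩, ContinuousMap.normTrunc_ne_zero.2 hn⟩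
        · exact absurd (hx a ha) hax
    refine ⟨J, (Ideal.span_eq_top_iff_forall_exists_apply_ne_zero e _).2 fun x => ?_⟩
    by_cases hx : ∃ a ∈ d, e a x ≠ 0
    · obtain ⟨a, ha, hax⟩ := hx
      exact ⟨a, Or.inl ha, hax⟩
    · push Not at hx
      obtain ⟨n, hn, hnx⟩ := Set.mem_iUnion₂.1 (hJ (Set.mem_iInter₂.2 hx))
      exact ⟨_, Or.inr ⟨n, hn, rfl⟩, by simpa using hnx⟩

theorem IsAlmostMaximal.isMaximal {A : Type u} [CommRing A] {X 𝕜 : Type*} [RCLike 𝕜]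
    [TopologicalSpace X] [CompactSpace X] [T2Space X] (e : A ≃+* C(X, 𝕜)) {P : Ideal A}
    (hP : IsAlmostMaximal P) : P.IsMaximal := by
  obtain ⟨M, hM, hPM⟩ := Ideal.exists_le_maximal P hP.isPrime.ne_top
  obtain ⟨x, hx⟩ := hM.exists_mem_iff_apply_eq_zero e
  suffices M ≤ P from le_antisymm hPM this ▸ hM
  intro c hcM
  by_contra hcP
  obtain ⟨n, hn⟩ := hP.exists_notMem _ _ c (maxCovers_normTrunc e c) hcP
  let ε : ℝ := 1 / (n.down + 1)
  have hε : 0 < ε := Nat.one_div_pos_of_nat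
  let h : C(X, 𝕜) := ⟨fun y => ((max (ε - ‖e c y‖) 0 : ℝ) : 𝕜), by fun_prop⟩
  have hmul : e.symm ((e c).normTrunc ε) * e.symm h = 0 := by
    rw [← map_mul, map_eq_zero_iff e.symm e.symm.injective]
    ext y
    rcases le_total ‖e c y‖ ε with hy | hy
    · simp [ContinuousMap.normTrunc, h, max_eq_right (sub_nonpos.2 hy)]
    · simp [h, max_eq_right (sub_nonpos.2 hy)]
  have hhM := hPM ((hP.isPrime.mem_or_mem (hmul ▸ P.zero_mem)).resolve_left hn)
  rw [hx] at hcM hhM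
  simp [h, hcM, hε.not_ge] at hhM

/-- Continuity is automatic, the topologies being induced from the prime spectra. -/
theorem isMaximalHom_of_isMaximal_comap {A : Type u} {B : Type v} [CommRing A] [CommRing B]
    {f : A →+* B} (h : ∀ M : Ideal B, M.IsMaximal → (M.comap f).IsMaximal) : IsMaximalHom f :=
  ⟨fun M => ⟨M.asIdeal.comap f, h _ M.isMaximal⟩,
    continuous_induced_rng.2 <| (PrimeSpectrum.continuous_comap f).comp
      MaximalSpectrum.toPrimeSpectrum_continuous, fun _ => rfl⟩

theorem isMaximalHom_of_surjective_eval {A : Type u} {B : Type v} [CommRing A] [CommRing B]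
    {Y 𝕜 : Type*} [RCLike 𝕜] [TopologicalSpace Y] [CompactSpace Y] [T2Space Y]
    (e : B ≃+* C(Y, 𝕜)) {f : A →+* B}
    (hf : ∀ y, Function.Surjective fun a => e (f a) y) : IsMaximalHom f := by
  refine isMaximalHom_of_isMaximal_comap fun M hM => ?_
  obtain ⟨y, hy⟩ := hM.exists_mem_iff_apply_eq_zero e
  let φ : A →+* 𝕜 := ((ContinuousMap.evalAlgHom 𝕜 𝕜 y : C(Y, 𝕜) →+* 𝕜).comp
    (e : B →+* C(Y, 𝕜))).comp f
  have hφ : M.comap f = RingHom.ker φ := by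
    ext a
    simp [Ideal.mem_comap, hy, RingHom.mem_ker, φ]
  exact hφ ▸ RingHom.ker_isMaximal_of_surjective φ (hf y)

theorem RingHom.surjective_of_algebra_real {A : Type*} [CommRing A] [Algebra ℝ A] (φ : A →+* ℝ) :
    Function.Surjective φ := fun r =>
  ⟨algebraMap ℝ A r, RingHom.congr_fun
    (Subsingleton.elim (φ.comp (algebraMap ℝ A)) (RingHom.id ℝ)) r⟩

/-- Commuting with conjugation forces `ψ` to map `ℝ` into `ℝ`, whose only ring endomorphism is the
identity. -/
theorem RingHom.apply_ofReal_of_map_star {ψ : ℂ →+* ℂ} (hψ : ∀ z, ψ (star z) = star (ψ z))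
    (r : ℝ) : ψ r = r := by
  have him (r : ℝ) : ((ψ r).re : ℂ) = ψ r := by
    have h := hψ r
    rw [Complex.star_def, Complex.conj_ofReal] at h
    exact Complex.conj_eq_iff_re.1 h.symm
  let ρ : ℝ →+* ℝ :=
    { toFun := fun r => (ψ r).re
      map_one' := by simp
      map_zero' := by simp
      map_add' := by simp
      map_mul' := fun r s => by
        apply Complex.ofReal_injective
        rw [him, Complex.ofReal_mul, Complex.ofReal_mul, him, him, map_mul] }
  have h : (ψ r).re = r := RingHom.congr_fun (Subsingleton.elim ρ (RingHom.id ℝ)) r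
  rw [← him, h]

theorem RingHom.surjective_of_map_star {ψ : ℂ →+* ℂ} (hψ : ∀ z, ψ (star z) = star (ψ z)) :
    Function.Surjective ψ := by
  have hI : ψ Complex.I * ψ Complex.I = -1 := by
    rw [← map_mul, Complex.I_mul_I, map_neg, map_one]
  intro z
  -- As `ψ I = ±I`, the factor `-(ψ I * I)` is that same sign, so the preimage is `z` or its
  -- conjugate.
  refine ⟨z.re + (z.im * (-(ψ Complex.I * Complex.I)).re : ℝ) * Complex.I, ?_⟩
  have h : (ψ Complex.I - Complex.I) * (ψ Complex.I + Complex.I) = 0 := by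
    linear_combination hI - Complex.I_mul_I
  rw [map_add, map_mul, apply_ofReal_of_map_star hψ, apply_ofReal_of_map_star hψ]
  rcases mul_eq_zero.1 h with h | h
  · simp [sub_eq_zero.1 h]
  · simp [eq_neg_of_add_eq_zero_left h]

theorem theorem4p3 :
    -- (i), real and complex
    (∀ (A : Type u) [CommRing A], IsRealCStarAlgebra A →
      ∀ P : Ideal A, P.IsPrime → (P.IsMaximal ↔ IsAlmostMaximal P)) ∧
    (∀ (A : Type u) [CommCStarAlgebra A],
      ∀ P : Ideal A, P.IsPrime → (P.IsMaximal ↔ IsAlmostMaximal P)) ∧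
    -- (ii), real and complex
    (∀ (A : Type u) (B : Type v) [CommRing A] [CommRing B],
      IsRealCStarAlgebra A → IsRealCStarAlgebra B →
        ∀ f : A →+* B, IsMaximalHom f) ∧
    (∀ (A : Type u) (B : Type v) [CommCStarAlgebra A] [CommCStarAlgebra B],
      ∀ f : A →+* B, (∀ a : A, f (star a) = star (f a)) → IsMaximalHom f) := by
  refine ⟨?_, ?_, ?_, ?_⟩
  · rintro A _ ⟨X, _, _, _, ⟨e⟩⟩ P -
    exact ⟨Ideal.IsMaximal.isAlmostMaximal, IsAlmostMaximal.isMaximal e⟩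
  · intro A _ P _
    exact ⟨Ideal.IsMaximal.isAlmostMaximal,
      IsAlmostMaximal.isMaximal (gelfandStarTransform A).toRingEquiv⟩
  · rintro A B _ _ ⟨X, _, _, _, ⟨e⟩⟩ ⟨Y, _, _, _, ⟨e'⟩⟩ f
    refine isMaximalHom_of_surjective_eval e' fun y r => ?_
    let φ : C(X, ℝ) →+* ℝ := (((ContinuousMap.evalAlgHom ℝ ℝ y : C(Y, ℝ) →+* ℝ).comp
      (e' : B →+* C(Y, ℝ))).comp f).comp (e.symm : C(X, ℝ) →+* A)
    obtain ⟨g, hg⟩ := φ.surjective_of_algebra_real r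
    exact ⟨e.symm g, hg⟩
  · intro A B _ _ f hf
    refine isMaximalHom_of_surjective_eval (gelfandStarTransform B).toRingEquiv fun y z => ?_
    let ψ : ℂ →+* ℂ := (((y : B →ₐ[ℂ] ℂ) : B →+* ℂ).comp f).comp (algebraMap ℂ A)
    have hψ (z : ℂ) : ψ (star z) = star (ψ z) := by
      change y (f (algebraMap ℂ A (star z))) = star (y (f (algebraMap ℂ A z)))
      rw [algebraMap_star_comm, hf, map_star]
    obtain ⟨w, hw⟩ := RingHom.surjective_of_map_star hψ z
    exact ⟨algebraMap ℂ A w, hw⟩
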